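/- Let $Y\to X$ be a smooth fibre bundle and $E\to X$ a smooth vector bundle (finite-dimensional, second countable Hausdorff manifolds). Let $\mathcal O_\infty Y$ be the ring of smooth real functions on the finite-order jet manifolds $J^rY$, and let $\mathcal E$ be an $E$-valued differential operator on $Y$ of finite order, with local components $\mathcal E^a\in\mathcal O_\infty Y$. Let $\mathcal S_\infty[E;Y]$ be the exterior algebra over $\mathcal O_\infty Y$ generated by the odd elements $c^a_\Lambda$ (fibre coordinates of jets of sections of $E$, of antifield number $1$), and let $\delta$ be the right graded $\mathcal O_\infty Y$-linear derivation with $\delta c^a_\Lambda=d_\Lambda\mathcal E^a$, where $d_\Lambda$ are the total derivatives. Write $\mathcal S_\infty[E;Y]_k$ for the elements of degree $k$. Suppose that $H_1(\delta)$ is finitely generated in the following sense: there are a smooth vector bundle $E_0\to X$ of finite rank and $\delta$-cycles $\Delta^r=\sum\Delta_a^{\Lambda r}c^a_\Lambda\in\mathcal S_\infty[E;Y]_1$ (the Noether operators), indexed by local frames of $E_0$ and transforming accordingly, whose classes form a projective $C^\infty(X)$-submodule of $H_1(\delta)$ isomorphic to the module of sections of a vector bundle (that is, $\sigma\mapsto[\sum\sigma_r\Delta^r]$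 is injective on sections of $E_0^*$), such that every $\delta$-cycle $\Phi\in\mathcal S_\infty[E;Y]_1$ is, up to a $\delta$-boundary, of the form $\sum G_r^\Xi d_\Xi\Delta^r$ with $G_r^\Xi\in\mathcal O_\infty Y$. Let $\mathcal P_\infty[E;Y;E_0]$ be the graded commutative $\mathcal O_\infty Y$-algebra generated by the odd $c^a_\Lambda$ and by even elements $c^r_\Xi$ of antifield number $2$ (fibre coordinates of jets of sections of $E_0$), let $\delta$ be extended to it by $\delta c^r_\Xi=0$, and let $\delta_0$ be the right graded $\mathcal O_\infty Y$-linear derivation with $\delta_0c^a_\Lambda=d_\Lambda\mathcal E^a$ and $\delta_0c^r_\Xi=d_\Xi\Delta^r$. Let $H_2(\delta_0)$ be the quotient of the $\delta_0$-cycles of antifield number $2$ by the $\delta_0$-images of elements of antifield number $3$. A $\delta_0$-cycle $$\Phi=G+H=\sum G_r^\Lambda c^r_\Lambda+\sum H_{ab}^{\Lambda\Sigma}c^a_\Lambda c^b_\Sigma$$ of antifield number $2$ amounts to a reduction condition $\sum G_r^\Lambda d_\Lambda\Delta^r+\delta H=0$ on the Noether operators. This condition is called trivial if $\Phi$ is a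 $\delta_0$-boundary or if its summand $G$ is $\delta$-exact, i.e. $G=\delta\Psi$ for some $\Psi\in\mathcal P_\infty[E;Y;E_0]$ of antifield number $3$. Nontrivial reduction conditions are called first-stage Noether identities. Then the following are equivalent: 1. First-stage Noether identities are identified with the nontrivial elements of $H_2(\delta_0)$: a $\delta_0$-cycle $\Phi$ of antifield number $2$ is a first-stage Noether identity if and only if its class in $H_2(\delta_0)$ is nonzero. 2. (Two-homology regularity condition.) Every $\delta$-cycle $\Phi\in\mathcal S_\infty[E;Y]_2$ is a $\delta_0$-boundary. -/

import Mathlib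

open scoped ContDiff Topology TensorProduct
set_option linter.unusedSectionVars false

namespace KoszulTate

section Calculus
variable {B C F G : Type*} [NormedAddCommGroup B] [NormedSpace ℝ B]
  [NormedAddCommGroup C] [NormedSpace ℝ C] [NormedAddCommGroup F] [NormedSpace ℝ F]
  [NormedAddCommGroup G] [NormedSpace ℝ G]

/-- Taylor coefficients up to order `r` of maps from `B` to `W`; the coordinate space of `r`-jets.
The derivatives of order `k` are the components of a `k`-linear map. In this way all the
multi-indices of length at most `r` are covered. -/
def Jet (B W : Type*) [NormedAddCommGroup B] [NormedSpace ℝ B] [NormedAddCommGroup W]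
    [NormedSpace ℝ W] (r : ℕ) : Type _ :=
  (k : Fin (r + 1)) → B [×(k : ℕ)]→L[ℝ] W

noncomputable instance (r : ℕ) : NormedAddCommGroup (Jet B C r) :=
  inferInstanceAs (NormedAddCommGroup ((k : Fin (r + 1)) → B [×(k : ℕ)]→L[ℝ] C))

noncomputable instance (r : ℕ) : NormedSpace ℝ (Jet B C r) :=
  inferInstanceAs (NormedSpace ℝ ((k : Fin (r + 1)) → B [×(k : ℕ)]→L[ℝ] C))

/-- The component of order `k`. -/
noncomputable def Jet.proj (r : ℕ) (k : Fin (r + 1)) : Jet B C r →L[ℝ] B [×(k : ℕ)]→L[ℝ] C :=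
  ContinuousLinearMap.proj (R := ℝ) (φ := fun k : Fin (r + 1) => B [×(k : ℕ)]→L[ℝ] C) k

/-- The inclusion of the component of order `k`. -/
noncomputable def Jet.single (r : ℕ) (k : Fin (r + 1)) : (B [×(k : ℕ)]→L[ℝ] C) →L[ℝ] Jet B C r :=
  ContinuousLinearMap.single ℝ (fun k : Fin (r + 1) => B [×(k : ℕ)]→L[ℝ] C) k

theorem Jet.proj_apply (r : ℕ) (k : Fin (r + 1)) (w : Jet B C r) : Jet.proj r k w = w k := rfl

theorem Jet.single_same (r : ℕ) (k : Fin (r + 1)) (w : B [×(k : ℕ)]→L[ℝ] C) :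
    Jet.single r k w k = w := Pi.single_eq_same (M := fun k : Fin (r + 1) => B [×(k : ℕ)]→L[ℝ] C) k w

theorem Jet.single_ne (r : ℕ) {k j : Fin (r + 1)} (h : j ≠ k) (w : B [×(k : ℕ)]→L[ℝ] C) :
    Jet.single r k w j = 0 :=
  Pi.single_eq_of_ne (M := fun k : Fin (r + 1) => B [×(k : ℕ)]→L[ℝ] C) h w

theorem Jet.ext {r : ℕ} {v w : Jet B C r} (h : ∀ k, v k = w k) : v = w := funext h

theorem Jet.sum_apply {r : ℕ} {ι : Type*} (s : Finset ι) (f : ι → Jet B C r) (k : Fin (r + 1)) :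
    (∑ i ∈ s, f i) k = ∑ i ∈ s, f i k :=
  map_sum (Jet.proj r k) f s

/-- The derivatives of `u` at `z` up to order `r`. -/
noncomputable def taylor (r : ℕ) (u : B → C) (z : B) : Jet B C r := fun k => iteratedFDeriv ℝ k u z

/-- Forgetting the derivatives of order greater than `r`. -/
noncomputable def Jet.res {r R : ℕ} (h : r ≤ R) : Jet B C R →L[ℝ] Jet B C r :=
  ContinuousLinearMap.pi (φ := fun k : Fin (r + 1) => B [×(k : ℕ)]→L[ℝ] C) fun k => Jet.proj R (Fin.castLE (Nat.succ_le_succ h) k)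

theorem Jet.res_taylor {r R : ℕ} (h : r ≤ R) (u : B → C) (z : B) :
    Jet.res h (taylor R u z) = taylor r u z := rfl

theorem Jet.res_res {r R S : ℕ} (h : r ≤ R) (h' : R ≤ S) (w : Jet B C S) :
    Jet.res h (Jet.res h' w) = Jet.res (h.trans h') w := rfl

/-- Extension of `Jet.res` to the coordinate spaces that include the base point. -/
noncomputable def Jet.pres {r R : ℕ} (h : r ≤ R) : B × Jet B C R →L[ℝ] B × Jet B C r :=
  (ContinuousLinearMap.id ℝ B).prodMap (Jet.res h)

theorem Jet.contDiff_pres {r R : ℕ} (h : r ≤ R) :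
    ContDiff ℝ ∞ (Jet.pres h : B × Jet B C R → B × Jet B C r) :=
  (Jet.pres h : B × Jet B C R →L[ℝ] B × Jet B C r).contDiff

/-- The derivative of the `r`-jet, as a function of the `(r+1)`-jet. -/
noncomputable def Jet.shift (r : ℕ) : Jet B C (r + 1) →L[ℝ] B →L[ℝ] Jet B C r :=
  ∑ k : Fin (r + 1),
    (ContinuousLinearMap.compL ℝ B (B [×(k : ℕ)]→L[ℝ] C) (Jet B C r)
      (Jet.single r k)) ∘L
    ((continuousMultilinearCurryLeftEquiv ℝ (fun _ : Fin ((k : ℕ) + 1) => B)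
      C).toContinuousLinearEquiv : (B [×((k : ℕ) + 1)]→L[ℝ] C) →L[ℝ] _) ∘L
    (Jet.proj (r + 1) k.succ :
      Jet B C (r + 1) →L[ℝ] B [×((k : ℕ) + 1)]→L[ℝ] C)

theorem Jet.shift_apply (r : ℕ) (w : Jet B C (r + 1)) (b : B) (k : Fin (r + 1)) :
    Jet.shift r w b k = ContinuousMultilinearMap.curryLeft
      (w k.succ : B [×((k : ℕ) + 1)]→L[ℝ] C) b := by
  rw [shift, _root_.sum_apply, _root_.sum_apply, Jet.sum_apply, Finset.sum_eq_single k]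
  · simp only [ContinuousLinearMap.comp_apply, ContinuousLinearMap.compL_apply, Jet.single_same]
    rfl
  · intro j _ hj
    simp only [ContinuousLinearMap.comp_apply, ContinuousLinearMap.compL_apply]
    rw [Jet.single_ne _ hj.symm]
  · simp

theorem hasFDerivAt_taylor (r : ℕ) {u : B → C} {z : B} (hu : ContDiffAt ℝ ∞ u z) :
    HasFDerivAt (taylor r u) (Jet.shift r (taylor (r + 1) u z)) z := by
  refine (hasFDerivAt_pi' (F' := fun k : Fin (r + 1) => B [×(k : ℕ)]→L[ℝ] C)).2 fun k => ?_
  have h : DifferentiableAt ℝ (iteratedFDeriv ℝ k u) z :=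
    hu.differentiableAt_iteratedFDeriv (by exact_mod_cast WithTop.coe_lt_top _)
  refine h.hasFDerivAt.congr_fderiv ?_
  ext1 b
  exact (Jet.shift_apply r (taylor (r + 1) u z) b k).symm

theorem contDiffAt_taylor (r : ℕ) {u : B → C} {z : B} (hu : ContDiffAt ℝ ∞ u z) :
    ContDiffAt ℝ ∞ (taylor r u) z := by
  refine (contDiffAt_pi (F' := fun k : Fin (r + 1) => B [×(k : ℕ)]→L[ℝ] C)).2 fun k => ?_
  exact hu.iteratedFDeriv_right (m := ∞) (i := k) (by exact_mod_cast le_top)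

theorem contDiff_clm_flip {W : Type*} [NormedAddCommGroup W] [NormedSpace ℝ W] :
    ContDiff ℝ ∞ (fun L : B →L[ℝ] W →L[ℝ] G => L.flip) :=
  (IsBoundedLinearMap.mk (by constructor <;> intros <;> rfl)
    ⟨1, one_pos, fun x => by rw [ContinuousLinearMap.opNorm_flip, one_mul]⟩ :
    IsBoundedLinearMap ℝ (fun L : B →L[ℝ] W →L[ℝ] G => L.flip)).contDiff

theorem totalDeriv_aux {V V' W W' : Type*} [NormedAddCommGroup V] [NormedSpace ℝ V]
    [NormedAddCommGroup V'] [NormedSpace ℝ V'] [NormedAddCommGroup W] [NormedSpace ℝ W]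
    [NormedAddCommGroup W'] [NormedSpace ℝ W'] (resV : V' →L[ℝ] V) (resW : W' →L[ℝ] W)
    {shV : V' → B →L[ℝ] V} (hsh : ContDiff ℝ ∞ shV) (shW : W' →L[ℝ] B →L[ℝ] W)
    {O : Set V} (hO : IsOpen O) {M : V → W →L[ℝ] G} (hM : ContDiffOn ℝ ∞ M O) :
    ∃ M' : V' → W' →L[ℝ] B →L[ℝ] G, ContDiffOn ℝ ∞ M' (resV ⁻¹' O) ∧
      ∀ (z : B) (u : B → V) (v : B → W) (u' : V') (v' : W'), u z = resV u' → v z = resW v' →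
        HasFDerivAt u (shV u') z → HasFDerivAt v (shW v') z → u z ∈ O →
        fderiv ℝ (fun z' => M (u z') (v z')) z = M' u' v' := by
  have h1 : ContDiffOn ℝ ∞ (fun w => fderiv ℝ M (resV w)) (resV ⁻¹' O) :=
    (hM.fderiv_of_isOpen hO (m := ∞) (by simp)).comp resV.contDiff.contDiffOn (fun _ h => h)
  have h2 : ContDiffOn ℝ ∞ (fun w => M (resV w)) (resV ⁻¹' O) :=
    hM.comp resV.contDiff.contDiffOn (fun _ h => h)
  have h4 : ContDiffOn ℝ ∞ (fun w => (fderiv ℝ M (resV w)).comp (shV w)) (resV ⁻¹' O) :=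
    h1.clm_comp hsh.contDiffOn
  refine ⟨fun w => ((fderiv ℝ M (resV w)).comp (shV w)).flip ∘L resW +
    (ContinuousLinearMap.compL ℝ B W G (M (resV w))) ∘L shW, ?_, ?_⟩
  · refine (ContDiffOn.clm_comp (contDiff_clm_flip.comp_contDiffOn h4) contDiffOn_const).add
      (ContDiffOn.clm_comp ?_ contDiffOn_const)
    exact ContDiffOn.clm_apply contDiffOn_const h2
  · intro z u v u' v' hu hv hdu hdv hz
    have hMd : HasFDerivAt M (fderiv ℝ M (u z)) (u z) :=
      ((hM.contDiffAt (hO.mem_nhds hz)).differentiableAt (by simp)).hasFDerivAt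
    have := (hMd.comp z hdu).clm_apply hdv
    refine this.fderiv.trans ?_
    ext b
    simp only [Function.comp_apply, hu, hv]
    simp [add_comm]

/-- The total derivative of a linear differential operator with coefficients depending on jets. -/
theorem exists_totalDeriv {q : ℕ} {O : Set (B × Jet B C q)} (hO : IsOpen O)
    {M : B × Jet B C q → Jet B F q →L[ℝ] G} (hM : ContDiffOn ℝ ∞ M O) :
    ∃ M' : B × Jet B C (q + 1) → Jet B F (q + 1) →L[ℝ] B →L[ℝ] G,
      ContDiffOn ℝ ∞ M' (Jet.pres q.le_succ ⁻¹' O) ∧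
      ∀ (z : B) (u : B → C) (v : B → F), ContDiffAt ℝ ∞ u z → ContDiffAt ℝ ∞ v z →
        (z, taylor q u z) ∈ O →
        fderiv ℝ (fun z' => M (z', taylor q u z') (taylor q v z')) z =
          M' (z, taylor (q + 1) u z) (taylor (q + 1) v z) := by
  have hsh : ContDiff ℝ ∞ (fun w : B × Jet B C (q + 1) =>
      (ContinuousLinearMap.id ℝ B).prod (Jet.shift q w.2)) := by
    have : (fun w : B × Jet B C (q + 1) => (ContinuousLinearMap.id ℝ B).prod (Jet.shift q w.2)) =
        fun w => ContinuousLinearMap.inl ℝ B (Jet B C q) +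
          (ContinuousLinearMap.inr ℝ B (Jet B C q)).comp (Jet.shift q w.2) := by
      funext w
      ext b <;> simp
    rw [this]
    exact contDiff_const.add (contDiff_const.clm_comp ((Jet.shift q).contDiff.comp contDiff_snd))
  obtain ⟨M', h1, h2⟩ := totalDeriv_aux (Jet.pres q.le_succ) (Jet.res q.le_succ)
    hsh (Jet.shift q) hO hM
  refine ⟨M', h1, fun z u v hu hv hz => ?_⟩
  exact h2 z (fun z' => (z', taylor q u z')) (taylor q v) (z, taylor (q + 1) u z)
    (taylor (q + 1) v z) rfl rfl ((hasFDerivAt_id z).prodMk (hasFDerivAt_taylor q hu))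
    (hasFDerivAt_taylor q hv) hz

theorem exists_iterated {q : ℕ} {O : Set (B × Jet B C q)} (hO : IsOpen O)
    {M : B × Jet B C q → Jet B F q →L[ℝ] G} (hM : ContDiffOn ℝ ∞ M O) (k : ℕ) :
    ∃ M' : B × Jet B C (q + k) → Jet B F (q + k) →L[ℝ] B [×k]→L[ℝ] G,
      ContDiffOn ℝ ∞ M' (Jet.pres (q.le_add_right k) ⁻¹' O) ∧
      ∀ (z : B) (u : B → C) (v : B → F), (∀ᶠ z' in 𝓝 z, ContDiffAt ℝ ∞ u z') →
        (∀ᶠ z' in 𝓝 z, ContDiffAt ℝ ∞ v z') → (z, taylor q u z) ∈ O →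
        iteratedFDeriv ℝ k (fun z' => M (z', taylor q u z') (taylor q v z')) z =
          M' (z, taylor (q + k) u z) (taylor (q + k) v z) := by
  induction k with
  | zero =>
    refine ⟨fun w => ((continuousMultilinearCurryFin0 ℝ B G).symm.toContinuousLinearEquiv :
      G →L[ℝ] _) ∘L M w, contDiffOn_const.clm_comp hM, ?_⟩
    intro z u v hu hv hz
    rfl
  | succ k ih =>
    obtain ⟨N, hN, hN'⟩ := ih
    obtain ⟨N', hNs, hNd⟩ := exists_totalDeriv
      (hO.preimage (Jet.pres (q.le_add_right k)).continuous) hN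
    refine ⟨fun w => ((continuousMultilinearCurryLeftEquiv ℝ (fun _ : Fin (k + 1) => B)
      G).symm.toContinuousLinearEquiv : _ →L[ℝ] B [×(k + 1)]→L[ℝ] G) ∘L N' w,
      contDiffOn_const.clm_comp hNs, ?_⟩
    intro z u v hu hv hz
    have ho : ∀ᶠ z' in 𝓝 z, (z', taylor q u z') ∈ O :=
      (continuousAt_id.prodMk (contDiffAt_taylor q hu.self_of_nhds).continuousAt).eventually_mem
        (hO.mem_nhds hz)
    have he : iteratedFDeriv ℝ k (fun z' => M (z', taylor q u z') (taylor q v z')) =ᶠ[𝓝 z]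
        fun z' => N (z', taylor (q + k) u z') (taylor (q + k) v z') := by
      filter_upwards [hu.eventually_nhds, hv.eventually_nhds, ho] with z' h1 h2 h3
      exact hN' z' u v h1 h2 h3
    rw [iteratedFDeriv_succ_eq_comp_left, Function.comp_apply, he.fderiv_eq,
      hNd z u v hu.self_of_nhds hv.self_of_nhds hz]
    rfl

/-- Prolongation of a linear differential operator with coefficients depending on jets. -/
theorem exists_prolong {q : ℕ} {O : Set (B × Jet B C q)} (hO : IsOpen O)
    {M : B × Jet B C q → Jet B F q →L[ℝ] G} (hM : ContDiffOn ℝ ∞ M O) (r : ℕ) :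
    ∃ M' : B × Jet B C (q + r) → Jet B F (q + r) →L[ℝ] Jet B G r,
      ContDiffOn ℝ ∞ M' (Jet.pres (q.le_add_right r) ⁻¹' O) ∧
      ∀ (z : B) (u : B → C) (v : B → F), (∀ᶠ z' in 𝓝 z, ContDiffAt ℝ ∞ u z') →
        (∀ᶠ z' in 𝓝 z, ContDiffAt ℝ ∞ v z') → (z, taylor q u z) ∈ O →
        taylor r (fun z' => M (z', taylor q u z') (taylor q v z')) z =
          M' (z, taylor (q + r) u z) (taylor (q + r) v z) := by
  choose N hN hN' using exists_iterated hO hM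
  have hk : ∀ k : Fin (r + 1), q + (k : ℕ) ≤ q + r := fun k => by have := k.2; omega
  refine ⟨fun w => ∑ k : Fin (r + 1),
    (Jet.single r k) ∘L
      (N k (Jet.pres (hk k) w)) ∘L Jet.res (hk k), ?_, ?_⟩
  · refine ContDiffOn.sum fun k _ => contDiffOn_const.clm_comp (ContDiffOn.clm_comp ?_ contDiffOn_const)
    exact (hN k).comp (Jet.contDiff_pres (hk k)).contDiffOn (fun w hw => hw)
  · intro z u v hu hv hz
    refine Jet.ext fun k => ?_
    rw [_root_.sum_apply, Jet.sum_apply, Finset.sum_eq_single k]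
    · simp only [ContinuousLinearMap.comp_apply, Jet.single_same]
      exact hN' k z u v hu hv hz
    · intro j _ hj
      simp only [ContinuousLinearMap.comp_apply]
      rw [Jet.single_ne _ hj.symm]
    · simp

/-- Prolongation of a nonlinear differential operator. -/
theorem exists_prolong' {q : ℕ} {O : Set (B × Jet B C q)} (hO : IsOpen O)
    {f : B × Jet B C q → G} (hf : ContDiffOn ℝ ∞ f O) (r : ℕ) :
    ∃ f' : B × Jet B C (q + r) → Jet B G r,
      ContDiffOn ℝ ∞ f' (Jet.pres (q.le_add_right r) ⁻¹' O) ∧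
      ∀ (z : B) (u : B → C), (∀ᶠ z' in 𝓝 z, ContDiffAt ℝ ∞ u z') → (z, taylor q u z) ∈ O →
        taylor r (fun z' => f (z', taylor q u z')) z = f' (z, taylor (q + r) u z) := by
  let ev : Jet B ℝ q →L[ℝ] ℝ :=
    ((continuousMultilinearCurryFin0 ℝ B ℝ).toContinuousLinearEquiv :
      (B [×0]→L[ℝ] ℝ) →L[ℝ] ℝ) ∘L
      (Jet.proj q (0 : Fin (q + 1)) : Jet B ℝ q →L[ℝ] B [×0]→L[ℝ] ℝ)
  have hM : ContDiffOn ℝ ∞ (fun w => ContinuousLinearMap.smulRightL ℝ (Jet B ℝ q) G ev (f w)) O :=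
    (ContinuousLinearMap.smulRightL ℝ (Jet B ℝ q) G ev).contDiff.comp_contDiffOn hf
  obtain ⟨M, h1, h2⟩ := exists_prolong hO hM r
  have hc : ∀ z : B, taylor (q + r) (fun _ : B => (1 : ℝ)) z = taylor (q + r) (fun _ => (1 : ℝ)) 0 := by
    intro z
    refine Jet.ext fun k => ?_
    simp only [taylor]
    rcases Nat.eq_zero_or_pos (k : ℕ) with h | h
    · rw [h]; rfl
    · rw [iteratedFDeriv_const_of_ne h.ne']; rfl
  refine ⟨fun w => M w (taylor (q + r) (fun _ => (1 : ℝ)) 0), h1.clm_apply contDiffOn_const, ?_⟩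
  intro z u hu hz
  have := h2 z u (fun _ => (1 : ℝ)) hu (Filter.Eventually.of_forall fun _ => contDiffAt_const) hz
  rw [hc] at this
  refine Eq.trans ?_ this
  congr 1
  funext z'
  have : ev (taylor q (fun _ => (1 : ℝ)) z') = 1 := rfl
  simp [this]
end Calculus

section Algebra
variable (R M N : Type*) [CommRing R] [AddCommGroup M] [Module R M] [AddCommGroup N] [Module R N]

/-- The graded commutative ring over `R` with odd generators `M` and even generators `N`: the
tensor product of the exterior algebra of `M` and the symmetric algebra of `N`. -/
def GradedRing : Type _ := ExteriorAlgebra R M ⊗[R] SymmetricAlgebra R N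

noncomputable instance : Ring (GradedRing R M N) :=
  inferInstanceAs (Ring (ExteriorAlgebra R M ⊗[R] SymmetricAlgebra R N))

noncomputable instance : Algebra R (GradedRing R M N) :=
  inferInstanceAs (Algebra R (ExteriorAlgebra R M ⊗[R] SymmetricAlgebra R N))

/-- The product `ω p` of an element of the exterior algebra and one of the symmetric algebra. -/
noncomputable def tmul :
    ExteriorAlgebra R M →ₗ[R] SymmetricAlgebra R N →ₗ[R] GradedRing R M N :=
  TensorProduct.mk R (ExteriorAlgebra R M) (SymmetricAlgebra R N)

variable {R M N}

variable (N) in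
/-- The right graded derivation `δ` over `R` with `δ c = ε c` for odd generators `c` and
`δ c = 0` for even generators. On the exterior algebra it is the right contraction with `ε`,
that is, `δ (f c) = ε c • f - δ f c`. -/
noncomputable def delta (ε : M →ₗ[R] R) : GradedRing R M N →ₗ[R] GradedRing R M N :=
  LinearMap.rTensor (SymmetricAlgebra R N)
    ((CliffordAlgebra.contractRight (Q := (0 : QuadraticForm R M))).flip ε)

/-- The algebra map `p ↦ p + D p`, where `D` is the derivation of `symDer`. -/
noncomputable def symHom (d : N →ₗ[R] M) : SymmetricAlgebra R N →ₐ[R]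
    TrivSqZeroExt (SymmetricAlgebra R N) (SymmetricAlgebra R N ⊗[R] M) :=
  SymmetricAlgebra.lift
    ((TrivSqZeroExt.inlAlgHom R (SymmetricAlgebra R N)
        (SymmetricAlgebra R N ⊗[R] M)).toLinearMap ∘ₗ SymmetricAlgebra.ι R N +
      (TrivSqZeroExt.inrHom (SymmetricAlgebra R N)
        (SymmetricAlgebra R N ⊗[R] M)).restrictScalars R ∘ₗ TensorProduct.mk R _ _ 1 ∘ₗ d)

/-- The derivation of the symmetric algebra that sends an even generator `n` to `d n`, which
is an element of degree one in the odd generators. -/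
noncomputable def symDer (d : N →ₗ[R] M) :
    SymmetricAlgebra R N →ₗ[R] SymmetricAlgebra R N ⊗[R] M :=
  (TrivSqZeroExt.sndHom (SymmetricAlgebra R N)
    (SymmetricAlgebra R N ⊗[R] M)).restrictScalars R ∘ₗ (symHom d).toLinearMap

theorem symDer_ι (d : N →ₗ[R] M) (n : N) :
    symDer d (SymmetricAlgebra.ι R N n) = 1 ⊗ₜ d n := by
  simp [symDer, symHom]

theorem symHom_fst (d : N →ₗ[R] M) (p : SymmetricAlgebra R N) : (symHom d p).fst = p := by
  have : (TrivSqZeroExt.fstHom R (SymmetricAlgebra R N)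
      (SymmetricAlgebra R N ⊗[R] M)).comp (symHom d) = AlgHom.id R _ := by
    ext n
    simp [symHom]
  exact DFunLike.congr_fun this p

theorem symDer_mul (d : N →ₗ[R] M) (p q : SymmetricAlgebra R N) :
    symDer d (p * q) = p • symDer d q + q • symDer d p := by
  simp [symDer, symHom_fst]

variable (R M N) in
/-- The map `ω, q ⊗ m ↦ (ω m) q`. -/
noncomputable def attach :
    ExteriorAlgebra R M →ₗ[R] SymmetricAlgebra R N ⊗[R] M →ₗ[R] GradedRing R M N :=
  (LinearMap.rTensorHom (SymmetricAlgebra R N) ∘ₗ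
    (LinearMap.mul R (ExteriorAlgebra R M)).compl₂ (ExteriorAlgebra.ι R)).compl₂
      (TensorProduct.comm R (SymmetricAlgebra R N) M).toLinearMap

/-- The right derivation over `R` that sends an even generator `n` to the odd element `d n` and
an odd generator to zero. -/
noncomputable def deltaEven (d : N →ₗ[R] M) : GradedRing R M N →ₗ[R] GradedRing R M N :=
  TensorProduct.lift ((attach R M N).compl₂ (symDer d))

/-- The extended differential `δ₀`: the right graded derivation over `R` with `δ₀ c = ε c` for
odd generators and `δ₀ n = d n` for even generators; see `delta₀_mul_odd` and `delta₀_mul_even`. -/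
noncomputable def delta₀ (ε : M →ₗ[R] R) (d : N →ₗ[R] M) :
    GradedRing R M N →ₗ[R] GradedRing R M N :=
  delta N ε + deltaEven d

variable (N) in
/-- The odd generators. -/
noncomputable def odd : M →ₗ[R] GradedRing R M N :=
  (tmul R M N).flip 1 ∘ₗ ExteriorAlgebra.ι R

variable (M) in
/-- The even generators. -/
noncomputable def even : N →ₗ[R] GradedRing R M N :=
  tmul R M N 1 ∘ₗ SymmetricAlgebra.ι R N

theorem tmul_mul_tmul (a b : ExteriorAlgebra R M) (p q : SymmetricAlgebra R N) :
    tmul R M N a p * tmul R M N b q = tmul R M N (a * b) (p * q) :=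
  Algebra.TensorProduct.tmul_mul_tmul a b p q

theorem delta_tmul (ε : M →ₗ[R] R) (a : ExteriorAlgebra R M) (p : SymmetricAlgebra R N) :
    delta N ε (tmul R M N a p) =
      tmul R M N (CliffordAlgebra.contractRight (Q := (0 : QuadraticForm R M)) a ε) p := rfl

theorem attach_tmul (a : ExteriorAlgebra R M) (q : SymmetricAlgebra R N) (m : M) :
    attach R M N a (q ⊗ₜ m) = tmul R M N (a * ExteriorAlgebra.ι R m) q := rfl

theorem deltaEven_tmul (d : N →ₗ[R] M) (a : ExteriorAlgebra R M) (p : SymmetricAlgebra R N) :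
    deltaEven d (tmul R M N a p) = attach R M N a (symDer d p) := rfl

theorem symDer_one (d : N →ₗ[R] M) : symDer d 1 = 0 := by simp [symDer]

theorem delta₀_one (ε : M →ₗ[R] R) (d : N →ₗ[R] M) : delta₀ ε d 1 = 0 := by
  have : (1 : GradedRing R M N) = tmul R M N 1 1 := rfl
  rw [this, delta₀, LinearMap.add_apply, delta_tmul, deltaEven_tmul,
    CliffordAlgebra.contractRight_one, symDer_one, map_zero, map_zero, LinearMap.zero_apply,
    add_zero]

theorem induct {motive : GradedRing R M N → Prop} (f : GradedRing R M N) (h0 : motive 0)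
    (ht : ∀ a p, motive (tmul R M N a p)) (ha : ∀ f g, motive f → motive g → motive (f + g)) :
    motive f := TensorProduct.induction_on (motive := motive) f h0 ht ha

theorem delta₀_mul_odd (ε : M →ₗ[R] R) (d : N →ₗ[R] M) (f : GradedRing R M N) (c : M) :
    delta₀ ε d (f * odd N c) = ε c • f - delta₀ ε d f * odd N c := by
  induction f using induct with
  | h0 => simp
  | ha f g hf hg => rw [add_mul, map_add, hf, hg, map_add, add_mul, smul_add]; abel
  | ht a p =>
    have h : ∀ t, attach R M N (a * ExteriorAlgebra.ι R c) t = - (attach R M N a t * odd N c) := by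
      intro t
      induction t using TensorProduct.induction_on with
      | zero => rw [map_zero, map_zero, zero_mul, neg_zero]
      | add x y hx hy => rw [map_add, map_add, hx, hy, ← neg_add, ← add_mul]
      | tmul q m =>
        have h2 := ExteriorAlgebra.ι_add_mul_swap (R := R) c m
        rw [attach_tmul, attach_tmul, odd, LinearMap.comp_apply, LinearMap.flip_apply,
          tmul_mul_tmul, mul_one, mul_assoc, mul_assoc, eq_neg_of_add_eq_zero_left h2,
          mul_neg, map_neg, LinearMap.neg_apply]
    have hc : CliffordAlgebra.contractRight (Q := (0 : QuadraticForm R M))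
        (a * ExteriorAlgebra.ι R c) ε = ε c • a -
        CliffordAlgebra.contractRight (Q := (0 : QuadraticForm R M)) a ε * ExteriorAlgebra.ι R c :=
      CliffordAlgebra.contractRight_mul_ι (Q := (0 : QuadraticForm R M)) ε c a
    have hm : tmul R M N a p * odd N c = tmul R M N (a * ExteriorAlgebra.ι R c) p := by
      rw [odd, LinearMap.comp_apply, LinearMap.flip_apply, tmul_mul_tmul, mul_one]
    rw [hm, delta₀, LinearMap.add_apply, LinearMap.add_apply, delta_tmul, delta_tmul,
      deltaEven_tmul, deltaEven_tmul, h, add_mul, odd, LinearMap.comp_apply, LinearMap.flip_apply,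
      tmul_mul_tmul, mul_one, hc, map_sub, LinearMap.sub_apply, map_smul, LinearMap.smul_apply]
    abel

theorem delta₀_mul_even (ε : M →ₗ[R] R) (d : N →ₗ[R] M) (f : GradedRing R M N) (c : N) :
    delta₀ ε d (f * even M c) = delta₀ ε d f * even M c + f * odd N (d c) := by
  induction f using induct with
  | h0 => simp
  | ha f g hf hg => rw [add_mul, map_add, hf, hg, map_add, add_mul, add_mul]; abel
  | ht a p =>
    have h : ∀ t, attach R M N a (SymmetricAlgebra.ι R N c • t) =
        attach R M N a t * even M c := by
      intro t
      induction t using TensorProduct.induction_on with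
      | zero => rw [smul_zero, map_zero, zero_mul]
      | add x y hx hy => rw [smul_add, map_add, map_add, hx, hy, ← add_mul]
      | tmul q m =>
        rw [TensorProduct.smul_tmul', smul_eq_mul, attach_tmul, attach_tmul, even,
          LinearMap.comp_apply, tmul_mul_tmul, mul_one, mul_comm q]
    rw [even, LinearMap.comp_apply, tmul_mul_tmul, mul_one, delta₀, LinearMap.add_apply,
      LinearMap.add_apply, delta_tmul, delta_tmul, deltaEven_tmul, deltaEven_tmul, symDer_mul,
      map_add, h, symDer_ι, TensorProduct.smul_tmul', smul_eq_mul, mul_one, attach_tmul, add_mul,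
      tmul_mul_tmul, mul_one, odd, LinearMap.comp_apply, LinearMap.flip_apply, tmul_mul_tmul,
      mul_one, even, LinearMap.comp_apply]
    abel
variable (R M N) in
/-- The elements of degree `k` in the odd generators and of degree `m` in the even generators. -/
noncomputable def bidegree (k m : ℕ) : Submodule R (GradedRing R M N) :=
  Submodule.map₂ (tmul R M N) (⋀[R]^k M) (LinearMap.range (SymmetricAlgebra.ι R N) ^ m)

variable (R M N) in
/-- The elements of antifield number `n`: odd generators have antifield number one and even
generators have antifield number two. -/
noncomputable def antifield (n : ℕ) : Submodule R (GradedRing R M N) :=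
  ⨆ (k : ℕ) (m : ℕ) (_ : k + 2 * m = n), bidegree R M N k m

/-- The one-boundaries of `δ`: the elements `δ H` where `H` has degree two in the odd generators. -/
noncomputable def boundaries₁ (ε : M →ₗ[R] R) : Submodule R M :=
  ((⋀[R]^2 M).map ((CliffordAlgebra.contractRight (Q := (0 : QuadraticForm R M))).flip ε)).comap
    (ExteriorAlgebra.ι R)

/-- The two-cycles of `δ₀`, that is, the reduction conditions `Σ G d(c) + δ H = 0`. -/
noncomputable def cycles₂ (ε : M →ₗ[R] R) (d : N →ₗ[R] M) : Submodule R (GradedRing R M N) :=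
  antifield R M N 2 ⊓ LinearMap.ker (delta₀ ε d)

/-- The two-boundaries of `δ₀`. -/
noncomputable def boundaries₂ (ε : M →ₗ[R] R) (d : N →ₗ[R] M) : Submodule R (GradedRing R M N) :=
  (antifield R M N 3).map (delta₀ ε d)

/-- The second homology of `δ₀`. -/
abbrev H₂ (ε : M →ₗ[R] R) (d : N →ₗ[R] M) : Type _ :=
  cycles₂ ε d ⧸ (boundaries₂ ε d).submoduleOf (cycles₂ ε d)

/-- The homology class of a two-cycle. -/
noncomputable def homologyClass (ε : M →ₗ[R] R) (d : N →ₗ[R] M) : cycles₂ ε d →ₗ[R] H₂ ε d :=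
  Submodule.mkQ _

/-- A two-cycle `Φ = G + H`, where `G` is linear in the even generators and `H` is of degree two in
the odd generators, is a trivial reduction condition if it is a boundary of `δ₀` or if its summand
`G` is exact with respect to `δ`. -/
def IsTrivialReduction (ε : M →ₗ[R] R) (d : N →ₗ[R] M) (Φ : cycles₂ ε d) : Prop :=
  Φ.1 ∈ boundaries₂ ε d ∨ ∃ G ∈ bidegree R M N 0 1, ∃ H ∈ bidegree R M N 2 0, Φ.1 = G + H ∧
    ∃ Ψ ∈ antifield R M N 3, delta N ε Ψ = G

/-- First-stage Noether identities: the nontrivial reduction conditions. -/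
def IsFirstStageNoetherIdentity (ε : M →ₗ[R] R) (d : N →ₗ[R] M) (Φ : cycles₂ ε d) :
    Prop :=
  ¬ IsTrivialReduction ε d Φ

/-- The two-homology regularity condition: every cycle of `δ` of degree two in the odd generators
(and without even generators) is a boundary of `δ₀`. -/
def TwoHomologyRegular (ε : M →ₗ[R] R) (d : N →ₗ[R] M) : Prop :=
  ∀ Φ ∈ bidegree R M N 2 0, delta N ε Φ = 0 → Φ ∈ boundaries₂ ε d
end Algebra

section JetFunctions
open scoped Manifold

variable (B C : Type*) [NormedAddCommGroup B] [NormedSpace ℝ B]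
  [NormedAddCommGroup C] [NormedSpace ℝ C]
  {X Y : Type*} [TopologicalSpace X] [ChartedSpace B X] [TopologicalSpace Y] [ChartedSpace C Y]
  (π : Y → X)

/-- A smooth fibre bundle with typical fibre `V`. -/
def IsSmoothFiberBundle {D : Type*} [NormedAddCommGroup D] [NormedSpace ℝ D] (V : Type*)
    [TopologicalSpace V] [ChartedSpace D V] : Prop :=
  Function.Surjective π ∧ ∀ x : X, ∃ e : Bundle.Trivialization V π, x ∈ e.baseSet ∧
    ContMDiffOn 𝓘(ℝ, C) (𝓘(ℝ, B).prod 𝓘(ℝ, D)) ∞ e e.source ∧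
    ContMDiffOn (𝓘(ℝ, B).prod 𝓘(ℝ, D)) 𝓘(ℝ, C) ∞ e.toOpenPartialHomeomorph.symm e.target

/-- `s` is a smooth section of `π` on a neighbourhood of `x`. -/
def IsLocalSection (s : X → Y) (x : X) : Prop :=
  ∀ᶠ x' in 𝓝 x, ContMDiffAt 𝓘(ℝ, B) 𝓘(ℝ, C) ∞ s x' ∧ π (s x') = x'

/-- A local section of `π` together with a point; it represents the infinite-order jet of the
section at the point, hence jets of all finite orders. -/
structure PointedSection where
  pt : X
  toFun : X → Y
  isLocalSection : IsLocalSection B C π toFun pt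

variable {B C π}

namespace PointedSection

/-- Coordinate expression of `p` in the charts at `p₀`. -/
noncomputable def rep (p₀ p : PointedSection B C π) : B → C := fun z =>
  chartAt C (p₀.toFun p₀.pt) (p.toFun ((chartAt B p₀.pt).symm z))

/-- The coordinates of the `r`-jet of `p` in the charts at `p₀`. -/
noncomputable def jetCoord (r : ℕ) (p₀ p : PointedSection B C π) : B × Jet B C r :=
  (chartAt B p₀.pt p.pt, taylor r (rep p₀ p) (chartAt B p₀.pt p.pt))

/-- The `0`-jet of `p` lies in the domain of the charts at `p₀`. -/
def Near (p₀ p : PointedSection B C π) : Prop :=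
  p.pt ∈ (chartAt B p₀.pt).source ∧ p.toFun p.pt ∈ (chartAt C (p₀.toFun p₀.pt)).source

/-- The same section at another point. -/
def move (p : PointedSection B C π) (x : X) (h : IsLocalSection B C π p.toFun x) :
    PointedSection B C π := ⟨x, p.toFun, h⟩

theorem near_self (p : PointedSection B C π) : Near p p :=
  ⟨mem_chart_source _ _, mem_chart_source _ _⟩

end PointedSection
open PointedSection

/-- In a neighbourhood of each `r`-jet, the object described by `rel` is given in coordinates by a
smooth function of the coordinates of `r`-jets: `rel p₀ p a` says that, in the charts at `p₀`, the
value of the object at `p` has the coordinates `a`. -/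
def HasSmoothForm (π : Y → X) {Z : Type*} [NormedAddCommGroup Z] [NormedSpace ℝ Z] (r : ℕ)
    (rel : PointedSection B C π → PointedSection B C π → Z → Prop) : Prop :=
  ∀ p₀ : PointedSection B C π, ∃ (O : Set (B × Jet B C r)) (f : B × Jet B C r → Z),
    IsOpen O ∧ jetCoord r p₀ p₀ ∈ O ∧ ContDiffOn ℝ ∞ f O ∧
      ∀ p, Near p₀ p → jetCoord r p₀ p ∈ O → rel p₀ p (f (jetCoord r p₀ p))

namespace HasSmoothForm
variable {Z Z' Z'' : Type*} [NormedAddCommGroup Z] [NormedSpace ℝ Z] [NormedAddCommGroup Z']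
  [NormedSpace ℝ Z'] [NormedAddCommGroup Z''] [NormedSpace ℝ Z'']
  {rel : PointedSection B C π → PointedSection B C π → Z → Prop}
  {rel' : PointedSection B C π → PointedSection B C π → Z' → Prop}
  {rel'' : PointedSection B C π → PointedSection B C π → Z'' → Prop}

theorem const {r : ℕ} (c : Z) (h : ∀ p₀ p, rel p₀ p c) : HasSmoothForm π r rel :=
  fun _ => ⟨Set.univ, fun _ => c, isOpen_univ, trivial, contDiffOn_const, fun _ _ _ => h _ _⟩

theorem mono {r R : ℕ} (h : r ≤ R) (hr : HasSmoothForm π r rel) : HasSmoothForm π R rel := by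
  intro p₀
  obtain ⟨O, f, hO, h0, hf, h1⟩ := hr p₀
  exact ⟨Jet.pres h ⁻¹' O, f ∘ Jet.pres h, hO.preimage (Jet.pres h).continuous, h0,
    hf.comp (Jet.contDiff_pres h).contDiffOn (fun _ h => h), fun p hp hpO => h1 p hp hpO⟩

theorem map {r : ℕ} (hr : HasSmoothForm π r rel) (g : Z → Z') (hg : ContDiff ℝ ∞ g)
    (h : ∀ p₀ p a, rel p₀ p a → rel' p₀ p (g a)) : HasSmoothForm π r rel' := by
  intro p₀
  obtain ⟨O, f, hO, h0, hf, h1⟩ := hr p₀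
  exact ⟨O, g ∘ f, hO, h0, hg.comp_contDiffOn hf, fun p hp hpO => h _ _ _ (h1 p hp hpO)⟩

theorem map₂ {r r' : ℕ} (hr : HasSmoothForm π r rel) (hr' : HasSmoothForm π r' rel')
    (g : Z × Z' → Z'') (hg : ContDiff ℝ ∞ g)
    (h : ∀ p₀ p a b, rel p₀ p a → rel' p₀ p b → rel'' p₀ p (g (a, b))) :
    HasSmoothForm π (max r r') rel'' := by
  intro p₀
  obtain ⟨O, f, hO, h0, hf, h1⟩ := hr.mono (le_max_left r r') p₀
  obtain ⟨O', f', hO', h0', hf', h1'⟩ := hr'.mono (le_max_right r r') p₀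
  exact ⟨O ∩ O', fun w => g (f w, f' w), hO.inter hO', ⟨h0, h0'⟩,
    hg.comp_contDiffOn ((hf.mono Set.inter_subset_left).prodMk (hf'.mono Set.inter_subset_right)),
    fun p hp hpO => h _ _ _ _ (h1 p hp hpO.1) (h1' p hp hpO.2)⟩
end HasSmoothForm

variable (B C π) in
/-- The ring `O_∞ Y` of smooth real functions on jet manifolds of finite order. A function of order
`r` is a function of pointed local sections which is, locally on the manifold of `r`-jets, a smooth
function of the jet coordinates. -/
def JetFunctions : Subalgebra ℝ (PointedSection B C π → ℝ) where
  carrier := {f | ∃ r, HasSmoothForm π r fun _ p a => f p = a}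
  mul_mem' := by
    rintro f g ⟨r, hf⟩ ⟨r', hg⟩
    exact ⟨_, hf.map₂ hg (fun w => w.1 * w.2) (contDiff_fst.mul contDiff_snd)
      (by rintro _ p a b rfl rfl; rfl)⟩
  add_mem' := by
    rintro f g ⟨r, hf⟩ ⟨r', hg⟩
    exact ⟨_, hf.map₂ hg (fun w => w.1 + w.2) (contDiff_fst.add contDiff_snd)
      (by rintro _ p a b rfl rfl; rfl)⟩
  algebraMap_mem' c := ⟨0, .const c fun _ _ => rfl⟩

section Bundle
variable (F : Type*) [NormedAddCommGroup F] [NormedSpace ℝ F]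
  (E : X → Type*) [∀ x, AddCommGroup (E x)] [∀ x, Module ℝ (E x)]
  [∀ x, TopologicalSpace (E x)] [TopologicalSpace (Bundle.TotalSpace F E)]
  [FiberBundle F E] [VectorBundle ℝ F E]

variable (B) in
/-- Sections of `E` that are smooth on a neighbourhood of `x`. -/
def LocalSections [ContMDiffVectorBundle ∞ F E 𝓘(ℝ, B)] (x : X) : Submodule ℝ (∀ x, E x) where
  carrier := {ψ | ∀ᶠ x' in 𝓝 x,
    ContMDiffAt 𝓘(ℝ, B) (𝓘(ℝ, B).prod 𝓘(ℝ, F)) ∞ (fun y => Bundle.TotalSpace.mk' F y (ψ y)) x'}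
  add_mem' ha hb := by
    filter_upwards [ha, hb] with x' h1 h2 using h1.add_section h2
  zero_mem' := Filter.Eventually.of_forall fun x' => Bundle.contMDiffAt_zeroSection ℝ E
  smul_mem' c a ha := by
    filter_upwards [ha] with x' h1 using h1.const_smul_section

variable (B) in
/-- Coordinate expression of a section of `E` in the chart and the trivialization at `x₀`. -/
noncomputable def secRep (x₀ : X) (ψ : ∀ x, E x) : B → F := fun z =>
  (trivializationAt F E x₀ ⟨(chartAt B x₀).symm z, ψ ((chartAt B x₀).symm z)⟩).2

variable [ContMDiffVectorBundle ∞ F E 𝓘(ℝ, B)]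

variable (B C π) in
/-- The `O_∞ Y`-module generated by the fibre coordinates `c^a_Λ` of jets of sections of `E`, that is,
of the expressions `Σ Φ_a^Λ c^a_Λ` with coefficients in `O_∞ Y`. Invariantly: smooth functions of
jets of sections of `Y` and `E`, of finite order, which are linear in the latter. -/
def LinearForms : Submodule (JetFunctions B C π)
    (∀ p : PointedSection B C π, LocalSections B F E p.pt →ₗ[ℝ] ℝ) where
  carrier := {Φ | ∃ r, HasSmoothForm π r fun p₀ p (a : Jet B F r →L[ℝ] ℝ) =>
    p.pt ∈ (trivializationAt F E p₀.pt).baseSet → ∀ ψ : LocalSections B F E p.pt,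
      Φ p ψ = a (taylor r (secRep B F E p₀.pt ψ) (chartAt B p₀.pt p.pt))}
  add_mem' := by
    rintro Φ Φ' ⟨r, h⟩ ⟨r', h'⟩
    refine ⟨max r r', h.map₂ h' (fun w => w.1.comp (Jet.res (le_max_left r r')) +
      w.2.comp (Jet.res (le_max_right r r'))) ((contDiff_fst.clm_comp contDiff_const).add
        (contDiff_snd.clm_comp contDiff_const)) fun p₀ p a b ha hb hp ψ => ?_⟩
    exact congrArg₂ (· + ·) (ha hp ψ) (hb hp ψ)
  zero_mem' := ⟨0, .const 0 fun _ _ _ _ => rfl⟩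
  smul_mem' := by
    rintro ⟨f, r, h⟩ Φ ⟨r', h'⟩
    refine ⟨max r r', h.map₂ h' (fun w => w.1 • w.2.comp (Jet.res (le_max_right r r')))
      (contDiff_fst.smul (contDiff_snd.clm_comp contDiff_const)) fun p₀ p a b ha hb hp ψ => ?_⟩
    exact congrArg₂ (· * ·) ha (hb hp ψ)

variable (B C π) in
/-- The ring `JetFunctions` as a type. -/
def JetRing : Type _ := JetFunctions B C π

noncomputable instance : CommRing (JetRing B C π) := inferInstanceAs (CommRing (JetFunctions B C π))

variable (B C π) in
/-- The module `LinearForms` as a type. -/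
def FormModule : Type _ := LinearForms B C π F E

noncomputable instance : AddCommGroup (FormModule B C π F E) :=
  inferInstanceAs (AddCommGroup (LinearForms B C π F E))

noncomputable instance : Module (JetRing B C π) (FormModule B C π F E) :=
  inferInstanceAs (Module (JetFunctions B C π) (LinearForms B C π F E))

theorem eventually_good [IsManifold 𝓘(ℝ, B) ∞ X] [IsManifold 𝓘(ℝ, C) ∞ Y]
    {p₀ p : PointedSection B C π} (hp : Near p₀ p) {r : ℕ} {O : Set (B × Jet B C r)}
    (hO : IsOpen O) (h : jetCoord r p₀ p ∈ O) :
    ∀ᶠ z in 𝓝 (chartAt B p₀.pt p.pt), z ∈ (chartAt B p₀.pt).target ∧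
      ContDiffAt ℝ ∞ (rep p₀ p) z ∧ (z, taylor r (rep p₀ p) z) ∈ O ∧
      ∃ h : IsLocalSection B C π p.toFun ((chartAt B p₀.pt).symm z), Near p₀ (p.move _ h) := by
  set χ := chartAt B p₀.pt with hχ
  have ht : ∀ᶠ z in 𝓝 (χ p.pt), z ∈ χ.target := χ.open_target.mem_nhds (χ.map_source hp.1)
  have hc : Filter.Tendsto χ.symm (𝓝 (χ p.pt)) (𝓝 p.pt) := by
    simpa [χ.left_inv hp.1] using (χ.continuousAt_symm (χ.map_source hp.1)).tendsto
  have hl : ∀ᶠ x in 𝓝 p.pt, IsLocalSection B C π p.toFun x := p.isLocalSection.eventually_nhds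
  have hs : ContinuousAt p.toFun p.pt := p.isLocalSection.self_of_nhds.1.continuousAt
  have hs' : ∀ᶠ x in 𝓝 p.pt, p.toFun x ∈ (chartAt C (p₀.toFun p₀.pt)).source :=
    hs.eventually_mem ((chartAt C (p₀.toFun p₀.pt)).open_source.mem_nhds hp.2)
  have hd : ∀ᶠ z in 𝓝 (χ p.pt), ContDiffAt ℝ ∞ (rep p₀ p) z := by
    filter_upwards [ht, hc.eventually p.isLocalSection, hc.eventually hs'] with z h1 h2 h3
    rw [← contMDiffAt_iff_contDiffAt]
    have a1 : ContMDiffAt 𝓘(ℝ, B) 𝓘(ℝ, B) ∞ χ.symm z :=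
      contMDiffAt_symm_of_mem_maximalAtlas (IsManifold.chart_mem_maximalAtlas p₀.pt) h1
    have a3 : ContMDiffAt 𝓘(ℝ, C) 𝓘(ℝ, C) ∞ (chartAt C (p₀.toFun p₀.pt))
        (p.toFun (χ.symm z)) :=
      contMDiffAt_of_mem_maximalAtlas (IsManifold.chart_mem_maximalAtlas _) h3
    exact a3.comp z (h2.1.comp z a1)
  have ho : ∀ᶠ z in 𝓝 (χ p.pt), (z, taylor r (rep p₀ p) z) ∈ O :=
    (continuousAt_id.prodMk (contDiffAt_taylor r hd.self_of_nhds).continuousAt).eventually_mem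
      (hO.mem_nhds h)
  filter_upwards [ht, hd, ho, hc.eventually hl, hc.eventually hs'] with z h1 h2 h3 h4 h5
  exact ⟨h1, h2, h3, h4, χ.map_target h1, h5⟩

theorem eventually_secRep [IsManifold 𝓘(ℝ, B) ∞ X] {x₀ x : X} (hx : x ∈ (chartAt B x₀).source)
    (hx' : x ∈ (trivializationAt F E x₀).baseSet) (ψ : LocalSections B F E x) :
    ∀ᶠ z in 𝓝 (chartAt B x₀ x), ContDiffAt ℝ ∞ (secRep B F E x₀ ψ) z := by
  set χ := chartAt B x₀ with hχ
  have ht : ∀ᶠ z in 𝓝 (χ x), z ∈ χ.target := χ.open_target.mem_nhds (χ.map_source hx)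
  have hc : Filter.Tendsto χ.symm (𝓝 (χ x)) (𝓝 x) := by
    simpa [χ.left_inv hx] using (χ.continuousAt_symm (χ.map_source hx)).tendsto
  have hb : ∀ᶠ y in 𝓝 x, y ∈ (trivializationAt F E x₀).baseSet :=
    (trivializationAt F E x₀).open_baseSet.mem_nhds hx'
  filter_upwards [ht, hc.eventually ψ.2, hc.eventually hb] with z h1 h2 h3
  rw [← contMDiffAt_iff_contDiffAt]
  have a1 : ContMDiffAt 𝓘(ℝ, B) 𝓘(ℝ, B) ∞ χ.symm z :=
    contMDiffAt_symm_of_mem_maximalAtlas (IsManifold.chart_mem_maximalAtlas x₀) h1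
  exact ((((trivializationAt F E x₀).contMDiffAt_section_iff h3).1 h2)).comp z a1

/-- A section that agrees near `x` with a smooth function of the chart is a local section. -/
theorem mem_localSections [IsManifold 𝓘(ℝ, B) ∞ X] {x₀ x : X} (hx : x ∈ (chartAt B x₀).source)
    (hx' : x ∈ (trivializationAt F E x₀).baseSet) (ψ : ∀ x, E x)
    (h : ∀ᶠ z in 𝓝 (chartAt B x₀ x), ContDiffAt ℝ ∞ (secRep B F E x₀ ψ) z) :
    ψ ∈ LocalSections B F E x := by
  set χ := chartAt B x₀ with hχ
  have hs : ∀ᶠ y in 𝓝 x, y ∈ χ.source := χ.open_source.mem_nhds hx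
  have hb : ∀ᶠ y in 𝓝 x, y ∈ (trivializationAt F E x₀).baseSet :=
    (trivializationAt F E x₀).open_baseSet.mem_nhds hx'
  filter_upwards [hs.eventually_nhds, hb, (χ.continuousAt hx).eventually h] with y h1 h2 h3
  rw [(trivializationAt F E x₀).contMDiffAt_section_iff h2]
  have a1 : ContMDiffAt 𝓘(ℝ, B) 𝓘(ℝ, B) ∞ χ y :=
    contMDiffAt_of_mem_maximalAtlas (IsManifold.chart_mem_maximalAtlas x₀) h1.self_of_nhds
  refine (h3.contMDiffAt.comp y a1).congr_of_eventuallyEq ?_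
  filter_upwards [h1] with y' h4
  change _ = (trivializationAt F E x₀ ⟨χ.symm (χ y'), ψ (χ.symm (χ y'))⟩).2
  rw [χ.left_inv h4]

theorem taylor_congr {W : Type*} [NormedAddCommGroup W] [NormedSpace ℝ W] {r : ℕ} {u v : B → W}
    {z : B} (h : u =ᶠ[𝓝 z] v) : taylor r u z = taylor r v z :=
  Jet.ext fun k => (h.iteratedFDeriv (𝕜 := ℝ) k).self_of_nhds

theorem secRep_congr [IsManifold 𝓘(ℝ, B) ∞ X] {x₀ x : X} (hx : x ∈ (chartAt B x₀).source)
    {ψ ψ' : ∀ x, E x} (h : ∀ᶠ y in 𝓝 x, ψ y = ψ' y) :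
    secRep B F E x₀ ψ =ᶠ[𝓝 (chartAt B x₀ x)] secRep B F E x₀ ψ' := by
  have hc : Filter.Tendsto (chartAt B x₀).symm (𝓝 (chartAt B x₀ x)) (𝓝 x) := by
    simpa [(chartAt B x₀).left_inv hx] using
      ((chartAt B x₀).continuousAt_symm ((chartAt B x₀).map_source hx)).tendsto
  filter_upwards [hc.eventually h] with z hz
  simp only [secRep, hz]

/-- The value of a linear form depends only on the germ. -/
theorem LinearForms.congr [IsManifold 𝓘(ℝ, B) ∞ X] (Φ : LinearForms B C π F E)
    (p : PointedSection B C π) {ψ ψ' : LocalSections B F E p.pt}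
    (h : ∀ᶠ y in 𝓝 p.pt, ψ.1 y = ψ'.1 y) : Φ.1 p ψ = Φ.1 p ψ' := by
  obtain ⟨Φ, r, hr⟩ := Φ
  obtain ⟨O, f, -, h0, -, h1⟩ := hr p
  have hb : p.pt ∈ (trivializationAt F E p.pt).baseSet := FiberBundle.mem_baseSet_trivializationAt' _
  rw [h1 p (near_self p) h0 hb ψ, h1 p (near_self p) h0 hb ψ',
    taylor_congr (secRep_congr F E (mem_chart_source B p.pt) h)]

variable (B C π) in
/-- Differential operators of finite order on `Y` with values in `E`: smooth bundle morphisms over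
`X` from a jet manifold of `Y` to `E`. -/
structure DifferentialOperator where
  toFun : ∀ p : PointedSection B C π, E p.pt
  smooth : ∃ r, HasSmoothForm π r fun p₀ p (a : F) =>
    p.pt ∈ (trivializationAt F E p₀.pt).baseSet →
      (trivializationAt F E p₀.pt ⟨p.pt, toFun p⟩).2 = a

variable {F E}

open Classical in
/-- The result of the operator on a local section, extended by zero. -/
noncomputable def DifferentialOperator.sectionFun (𝓔 : DifferentialOperator B C π F E)
    (p : PointedSection B C π) : ∀ x, E x := fun x =>
  if h : IsLocalSection B C π p.toFun x then 𝓔.toFun (p.move x h) else 0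

theorem DifferentialOperator.sectionFun_of (𝓔 : DifferentialOperator B C π F E)
    {p : PointedSection B C π} {x : X} (h : IsLocalSection B C π p.toFun x) :
    𝓔.sectionFun p x = 𝓔.toFun (p.move x h) := dif_pos h

theorem DifferentialOperator.exists_form [IsManifold 𝓘(ℝ, B) ∞ X] [IsManifold 𝓘(ℝ, C) ∞ Y]
    (𝓔 : DifferentialOperator B C π F E) : ∃ q, ∀ p₀ : PointedSection B C π,
    ∃ (O : Set (B × Jet B C q)) (f : B × Jet B C q → F),
      IsOpen O ∧ jetCoord q p₀ p₀ ∈ O ∧ ContDiffOn ℝ ∞ f O ∧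
      ∀ p, Near p₀ p → jetCoord q p₀ p ∈ O → p.pt ∈ (trivializationAt F E p₀.pt).baseSet →
        secRep B F E p₀.pt (𝓔.sectionFun p) =ᶠ[𝓝 (chartAt B p₀.pt p.pt)]
          fun z => f (z, taylor q (rep p₀ p) z) := by
  obtain ⟨q, hq⟩ := 𝓔.smooth
  refine ⟨q, fun p₀ => ?_⟩
  obtain ⟨O, f, hO, h0, hf, h1⟩ := hq p₀
  refine ⟨O, f, hO, h0, hf, fun p hp hpO hb => ?_⟩
  have hc : Filter.Tendsto (chartAt B p₀.pt).symm (𝓝 (chartAt B p₀.pt p.pt)) (𝓝 p.pt) := by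
    simpa [(chartAt B p₀.pt).left_inv hp.1] using
      ((chartAt B p₀.pt).continuousAt_symm ((chartAt B p₀.pt).map_source hp.1)).tendsto
  filter_upwards [eventually_good hp hO hpO,
    hc.eventually ((trivializationAt F E p₀.pt).open_baseSet.mem_nhds hb)] with z hz hzb
  obtain ⟨ht, hd, ho, hl, hn⟩ := hz
  have hj : jetCoord q p₀ (p.move _ hl) = (z, taylor q (rep p₀ p) z) := by
    have : chartAt B p₀.pt ((chartAt B p₀.pt).symm z) = z := (chartAt B p₀.pt).right_inv ht
    change (chartAt B p₀.pt ((chartAt B p₀.pt).symm z),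
      taylor q (rep p₀ p) (chartAt B p₀.pt ((chartAt B p₀.pt).symm z))) = _
    rw [this]
  have := h1 (p.move _ hl) hn (hj ▸ ho) hzb
  rw [hj] at this
  rw [← this]
  simp only [secRep]
  rw [𝓔.sectionFun_of hl]
  rfl

/-- The local section of `E` obtained by applying the operator to a local section of `Y`. -/
noncomputable def DifferentialOperator.prolong [IsManifold 𝓘(ℝ, B) ∞ X]
    [IsManifold 𝓘(ℝ, C) ∞ Y] (𝓔 : DifferentialOperator B C π F E)
    (p : PointedSection B C π) : LocalSections B F E p.pt :=
  ⟨𝓔.sectionFun p, by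
    obtain ⟨q, hq⟩ := 𝓔.exists_form
    obtain ⟨O, f, hO, h0, hf, h1⟩ := hq p
    have hb : p.pt ∈ (trivializationAt F E p.pt).baseSet :=
      FiberBundle.mem_baseSet_trivializationAt' _
    refine mem_localSections F E (mem_chart_source B p.pt) hb _ ?_
    filter_upwards [eventually_good (near_self p) hO h0,
      (h1 p (near_self p) h0 hb).eventuallyEq_nhds] with z hz he
    refine ContDiffAt.congr_of_eventuallyEq ?_ he
    exact (hf.contDiffAt (hO.mem_nhds hz.2.2.1)).comp z
      (contDiffAt_id.prodMk (contDiffAt_taylor q hz.2.1))⟩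

/-- The map `Σ Φ_a^Λ c^a_Λ ↦ Σ Φ_a^Λ d_Λ 𝓔^a`: a linear form is evaluated on the section of `E`
produced by `𝓔`, whose derivatives are the total derivatives of the components of `𝓔`. -/
noncomputable def DifferentialOperator.evalForm [IsManifold 𝓘(ℝ, B) ∞ X]
    [IsManifold 𝓘(ℝ, C) ∞ Y] (𝓔 : DifferentialOperator B C π F E) :
    FormModule B C π F E →ₗ[JetRing B C π] JetRing B C π where
  toFun Φ := ⟨fun p => Φ.1 p (𝓔.prolong p), by
    obtain ⟨Φ, r, hr⟩ := Φ
    obtain ⟨q, hq⟩ := 𝓔.exists_form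
    refine ⟨q + r, fun p₀ => ?_⟩
    obtain ⟨O, f, hO, h0, hf, h1⟩ := hq p₀
    obtain ⟨O', a, hO', h0', ha, h1'⟩ := hr p₀
    obtain ⟨f', hf', h2⟩ := exists_prolong' hO hf r
    let T : Set (B × Jet B C (q + r)) := Prod.fst ⁻¹' ((chartAt B p₀.pt).target ∩
      (chartAt B p₀.pt).symm ⁻¹' (trivializationAt F E p₀.pt).baseSet)
    have hT : IsOpen T := ((chartAt B p₀.pt).isOpen_inter_preimage_symm
      (trivializationAt F E p₀.pt).open_baseSet).preimage continuous_fst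
    refine ⟨Jet.pres (q.le_add_right r) ⁻¹' O ∩ Jet.pres (r.le_add_left q) ⁻¹' O' ∩ T,
      fun w => a (Jet.pres (r.le_add_left q) w) (f' w),
      ((hO.preimage (Jet.pres _).continuous).inter (hO'.preimage (Jet.pres _).continuous)).inter hT,
      ⟨⟨h0, h0'⟩, (chartAt B p₀.pt).map_source (mem_chart_source _ _), ?_⟩, ?_, ?_⟩
    · change (chartAt B p₀.pt).symm (chartAt B p₀.pt p₀.pt) ∈ (trivializationAt F E p₀.pt).baseSet
      rw [(chartAt B p₀.pt).left_inv (mem_chart_source _ _)]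
      exact FiberBundle.mem_baseSet_trivializationAt' _
    · exact (ha.comp (Jet.contDiff_pres _).contDiffOn fun w hw => hw.1.2).clm_apply
        (hf'.mono fun w hw => hw.1.1)
    · intro p hp hpO
      have hb : p.pt ∈ (trivializationAt F E p₀.pt).baseSet := by
        have : (chartAt B p₀.pt).symm (chartAt B p₀.pt p.pt) ∈
          (trivializationAt F E p₀.pt).baseSet := hpO.2.2
        rwa [(chartAt B p₀.pt).left_inv hp.1] at this
      have e1 := h1' p hp hpO.1.2 hb (𝓔.prolong p)
      have e2 := h2 (chartAt B p₀.pt p.pt) (rep p₀ p)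
        ((eventually_good hp hO hpO.1.1).mono fun z hz => hz.2.1) hpO.1.1
      refine e1.trans ?_
      have e3 : taylor r (secRep B F E p₀.pt (𝓔.prolong p).1) (chartAt B p₀.pt p.pt) = _ :=
        (taylor_congr (h1 p hp hpO.1.1 hb)).trans e2
      rw [e3]
      rfl⟩
  map_add' _ _ := rfl
  map_smul' _ _ := rfl

variable {F₀ : Type*} [NormedAddCommGroup F₀] [NormedSpace ℝ F₀]
  {E₀ : X → Type*} [∀ x, AddCommGroup (E₀ x)] [∀ x, Module ℝ (E₀ x)]
  [∀ x, TopologicalSpace (E₀ x)] [TopologicalSpace (Bundle.TotalSpace F₀ E₀)]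
  [FiberBundle F₀ E₀] [VectorBundle ℝ F₀ E₀] [ContMDiffVectorBundle ∞ F₀ E₀ 𝓘(ℝ, B)]

variable (B C π F E F₀ E₀) in
/-- Linear differential operators from sections of `E` to sections of `E₀` whose coefficients are
functions of jets of sections of `Y`. In local frames, such an operator is a collection
`Δ^r = Σ Δ_a^{Λ r} c^a_Λ` of elements of `LinearForms`, one for each element of the frame of `E₀`. -/
structure LinearOperator where
  toFun : ∀ p : PointedSection B C π, LocalSections B F E p.pt →ₗ[ℝ] E₀ p.pt
  smooth : ∃ r, HasSmoothForm π r fun p₀ p (a : Jet B F r →L[ℝ] F₀) =>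
    p.pt ∈ (trivializationAt F E p₀.pt).baseSet →
    p.pt ∈ (trivializationAt F₀ E₀ p₀.pt).baseSet →
      ∀ ψ : LocalSections B F E p.pt, (trivializationAt F₀ E₀ p₀.pt ⟨p.pt, toFun p ψ⟩).2 =
        a (taylor r (secRep B F E p₀.pt ψ) (chartAt B p₀.pt p.pt))

namespace LinearOperator

open Classical in
/-- The result of the operator on local sections, extended by zero. -/
noncomputable def sectionFun (Δ : LinearOperator B C π F E F₀ E₀)
    (p : PointedSection B C π) (ψ : ∀ x, E x) : ∀ x, E₀ x := fun x =>
  if h : IsLocalSection B C π p.toFun x ∧ ψ ∈ LocalSections B F E x then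
    Δ.toFun (p.move x h.1) ⟨ψ, h.2⟩ else 0

theorem sectionFun_of (Δ : LinearOperator B C π F E F₀ E₀)
    {p : PointedSection B C π} {ψ : ∀ x, E x} {x : X} (h : IsLocalSection B C π p.toFun x)
    (h' : ψ ∈ LocalSections B F E x) :
    Δ.sectionFun p ψ x = Δ.toFun (p.move x h) ⟨ψ, h'⟩ := dif_pos ⟨h, h'⟩

theorem exists_form [IsManifold 𝓘(ℝ, B) ∞ X] [IsManifold 𝓘(ℝ, C) ∞ Y]
    (Δ : LinearOperator B C π F E F₀ E₀) : ∃ q, ∀ p₀ : PointedSection B C π,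
    ∃ (O : Set (B × Jet B C q)) (f : B × Jet B C q → Jet B F q →L[ℝ] F₀),
      IsOpen O ∧ jetCoord q p₀ p₀ ∈ O ∧ ContDiffOn ℝ ∞ f O ∧
      ∀ p, Near p₀ p → jetCoord q p₀ p ∈ O → p.pt ∈ (trivializationAt F E p₀.pt).baseSet →
        p.pt ∈ (trivializationAt F₀ E₀ p₀.pt).baseSet → ∀ ψ : LocalSections B F E p.pt,
        secRep B F₀ E₀ p₀.pt (Δ.sectionFun p ψ) =ᶠ[𝓝 (chartAt B p₀.pt p.pt)]
          fun z => f (z, taylor q (rep p₀ p) z) (taylor q (secRep B F E p₀.pt ψ) z) := by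
  obtain ⟨q, hq⟩ := Δ.smooth
  refine ⟨q, fun p₀ => ?_⟩
  obtain ⟨O, f, hO, h0, hf, h1⟩ := hq p₀
  refine ⟨O, f, hO, h0, hf, fun p hp hpO hb hb₀ ψ => ?_⟩
  have hc : Filter.Tendsto (chartAt B p₀.pt).symm (𝓝 (chartAt B p₀.pt p.pt)) (𝓝 p.pt) := by
    simpa [(chartAt B p₀.pt).left_inv hp.1] using
      ((chartAt B p₀.pt).continuousAt_symm ((chartAt B p₀.pt).map_source hp.1)).tendsto
  filter_upwards [eventually_good hp hO hpO,
    hc.eventually ((trivializationAt F E p₀.pt).open_baseSet.mem_nhds hb),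
    hc.eventually ((trivializationAt F₀ E₀ p₀.pt).open_baseSet.mem_nhds hb₀),
    hc.eventually (Filter.Eventually.eventually_nhds ψ.2)] with z hz hzb hzb₀ hψ
  obtain ⟨ht, hd, ho, hl, hn⟩ := hz
  have hz' : chartAt B p₀.pt ((chartAt B p₀.pt).symm z) = z := (chartAt B p₀.pt).right_inv ht
  have hj : jetCoord q p₀ (p.move _ hl) = (z, taylor q (rep p₀ p) z) := by
    change (chartAt B p₀.pt ((chartAt B p₀.pt).symm z),
      taylor q (rep p₀ p) (chartAt B p₀.pt ((chartAt B p₀.pt).symm z))) = _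
    rw [hz']
  have := h1 (p.move _ hl) hn (hj ▸ ho) hzb hzb₀ ⟨ψ.1, hψ⟩
  rw [hj] at this
  simp only [secRep]
  rw [Δ.sectionFun_of hl hψ]
  refine this.trans ?_
  change f _ (taylor q _ (chartAt B p₀.pt ((chartAt B p₀.pt).symm z))) = _
  rw [hz']

/-- The local section of `E₀` obtained by applying the operator to local sections of `Y` and `E`. -/
noncomputable def prolong [IsManifold 𝓘(ℝ, B) ∞ X]
    [IsManifold 𝓘(ℝ, C) ∞ Y] (Δ : LinearOperator B C π F E F₀ E₀)
    (p : PointedSection B C π) (ψ : LocalSections B F E p.pt) : LocalSections B F₀ E₀ p.pt :=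
  ⟨Δ.sectionFun p ψ, by
    obtain ⟨q, hq⟩ := Δ.exists_form
    obtain ⟨O, f, hO, h0, hf, h1⟩ := hq p
    have hb : p.pt ∈ (trivializationAt F E p.pt).baseSet :=
      FiberBundle.mem_baseSet_trivializationAt' _
    have hb₀ : p.pt ∈ (trivializationAt F₀ E₀ p.pt).baseSet :=
      FiberBundle.mem_baseSet_trivializationAt' _
    refine mem_localSections F₀ E₀ (mem_chart_source B p.pt) hb₀ _ ?_
    filter_upwards [eventually_good (near_self p) hO h0,
      (h1 p (near_self p) h0 hb hb₀ ψ).eventuallyEq_nhds,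
      eventually_secRep F E (mem_chart_source B p.pt) hb ψ] with z hz he hψ
    refine ContDiffAt.congr_of_eventuallyEq ?_ he
    exact ((hf.contDiffAt (hO.mem_nhds hz.2.2.1)).comp z
      (contDiffAt_id.prodMk (contDiffAt_taylor q hz.2.1))).clm_apply (contDiffAt_taylor q hψ)⟩

/-- The map `Σ G_r^Ξ c^r_Ξ ↦ Σ G_r^Ξ d_Ξ Δ^r`: a linear form on sections of `E₀` is composed with the
operator. -/
noncomputable def compForm [IsManifold 𝓘(ℝ, B) ∞ X]
    [IsManifold 𝓘(ℝ, C) ∞ Y] (Δ : LinearOperator B C π F E F₀ E₀) :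
    FormModule B C π F₀ E₀ →ₗ[JetRing B C π] FormModule B C π F E where
  toFun G := ⟨fun p =>
    { toFun := fun ψ => G.1 p (Δ.prolong p ψ)
      map_add' := fun ψ ψ' => by
        rw [← map_add]
        refine LinearForms.congr F₀ E₀ G p ?_
        filter_upwards [p.isLocalSection.eventually_nhds, Filter.Eventually.eventually_nhds ψ.2,
          Filter.Eventually.eventually_nhds ψ'.2] with y h1 h2 h3
        change Δ.sectionFun p (ψ.1 + ψ'.1) y = Δ.sectionFun p ψ.1 y + Δ.sectionFun p ψ'.1 y
        rw [Δ.sectionFun_of h1 h2, Δ.sectionFun_of h1 h3,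
          Δ.sectionFun_of h1 ((LocalSections B F E y).add_mem h2 h3)]
        exact map_add (Δ.toFun (p.move y h1)) ⟨ψ.1, h2⟩ ⟨ψ'.1, h3⟩
      map_smul' := fun c ψ => by
        rw [RingHom.id_apply, ← map_smul]
        refine LinearForms.congr F₀ E₀ G p ?_
        filter_upwards [p.isLocalSection.eventually_nhds,
          Filter.Eventually.eventually_nhds ψ.2] with y h1 h2
        change Δ.sectionFun p (c • ψ.1) y = c • Δ.sectionFun p ψ.1 y
        rw [Δ.sectionFun_of h1 h2,
          Δ.sectionFun_of h1 ((LocalSections B F E y).smul_mem c h2)]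
        exact map_smul (Δ.toFun (p.move y h1)) c ⟨ψ.1, h2⟩ }, by
    obtain ⟨G, r, hr⟩ := G
    obtain ⟨q, hq⟩ := Δ.exists_form
    refine ⟨q + r, fun p₀ => ?_⟩
    obtain ⟨O, f, hO, h0, hf, h1⟩ := hq p₀
    obtain ⟨O', a, hO', h0', ha, h1'⟩ := hr p₀
    obtain ⟨f', hf', h2⟩ := exists_prolong hO hf r
    let T : Set (B × Jet B C (q + r)) := Prod.fst ⁻¹' ((chartAt B p₀.pt).target ∩
      (chartAt B p₀.pt).symm ⁻¹' (trivializationAt F₀ E₀ p₀.pt).baseSet)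
    have hT : IsOpen T := ((chartAt B p₀.pt).isOpen_inter_preimage_symm
      (trivializationAt F₀ E₀ p₀.pt).open_baseSet).preimage continuous_fst
    refine ⟨Jet.pres (q.le_add_right r) ⁻¹' O ∩ Jet.pres (r.le_add_left q) ⁻¹' O' ∩ T,
      fun w => (a (Jet.pres (r.le_add_left q) w)).comp (f' w),
      ((hO.preimage (Jet.pres _).continuous).inter (hO'.preimage (Jet.pres _).continuous)).inter hT,
      ⟨⟨h0, h0'⟩, (chartAt B p₀.pt).map_source (mem_chart_source _ _), ?_⟩, ?_, ?_⟩
    · change (chartAt B p₀.pt).symm (chartAt B p₀.pt p₀.pt) ∈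
        (trivializationAt F₀ E₀ p₀.pt).baseSet
      rw [(chartAt B p₀.pt).left_inv (mem_chart_source _ _)]
      exact FiberBundle.mem_baseSet_trivializationAt' _
    · exact (ha.comp (Jet.contDiff_pres _).contDiffOn fun w hw => hw.1.2).clm_comp
        (hf'.mono fun w hw => hw.1.1)
    · intro p hp hpO hb ψ
      have hb₀ : p.pt ∈ (trivializationAt F₀ E₀ p₀.pt).baseSet := by
        have : (chartAt B p₀.pt).symm (chartAt B p₀.pt p.pt) ∈
          (trivializationAt F₀ E₀ p₀.pt).baseSet := hpO.2.2
        rwa [(chartAt B p₀.pt).left_inv hp.1] at this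
      have e1 := h1' p hp hpO.1.2 hb₀ (Δ.prolong p ψ)
      have e2 := h2 (chartAt B p₀.pt p.pt) (rep p₀ p) (secRep B F E p₀.pt ψ)
        ((eventually_good hp hO hpO.1.1).mono fun z hz => hz.2.1)
        (eventually_secRep F E hp.1 hb ψ) hpO.1.1
      refine e1.trans ?_
      have e3 : taylor r (secRep B F₀ E₀ p₀.pt (Δ.prolong p ψ).1) (chartAt B p₀.pt p.pt) = _ :=
        (taylor_congr (h1 p hp hpO.1.1 hb hb₀ ψ)).trans e2
      rw [e3]
      rfl⟩
  map_add' _ _ := rfl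
  map_smul' _ _ := rfl

end LinearOperator

variable (F₀ E₀) in
/-- Complete Noether operators for `𝓔`, parametrized by sections of the dual of the vector bundle
`E₀`. In local frames these are the `Δ^r` of `LinearOperator`, and `compForm` restricted to the
linear forms of order zero `Σ σ_r c^r` with `σ_r` functions on `X` is the map `σ ↦ Σ σ_r Δ^r`. -/
structure CompleteNoetherOperators [IsManifold 𝓘(ℝ, B) ∞ X] [IsManifold 𝓘(ℝ, C) ∞ Y]
    (𝓔 : DifferentialOperator B C π F E) extends LinearOperator B C π F E F₀ E₀ where
  /-- Noether identities: each `Δ^r` is a one-cycle. -/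
  noether : ∀ p, toFun p (𝓔.prolong p) = 0
  /-- Different sections of the dual of `E₀` give different elements of the first homology. -/
  independent : ∀ (σ : ∀ x, E₀ x →ₗ[ℝ] ℝ) (c : FormModule B C π F₀ E₀),
    (∀ (p : PointedSection B C π) (η : LocalSections B F₀ E₀ p.pt),
      c.1 p η = σ p.pt (η.1 p.pt)) →
    toLinearOperator.compForm c ∈ boundaries₁ 𝓔.evalForm → c = 0
  /-- Every one-cycle is `Σ G_r^Ξ d_Ξ Δ^r` up to a boundary. -/
  complete : ∀ Φ : FormModule B C π F E, 𝓔.evalForm Φ = 0 →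
    ∃ G : FormModule B C π F₀ E₀, Φ - toLinearOperator.compForm G ∈ boundaries₁ 𝓔.evalForm
end Bundle
end JetFunctions
end KoszulTate

/-! The statement is one about differential graded algebra. Let `R` be the ring of jet functions,
`M` and `N` the modules of odd and even generators, `ε : M → R` the map `c ↦ δ c`, and `d : N → M`
the map given by the Noether operators. Then `δ₀ = δ + deltaEven d`. Geometry enters through one
identity, `ε ∘ d = 0`, which expresses the Noether identities and gives `δ₀² = 0`.

A boundary is a trivial reduction condition by definition, so condition 1 says exactly that every
trivial reduction condition is a boundary. Suppose that `Φ = G + H` is a cycle with `G = δ Ψ`.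
Subtracting the boundary `δ₀ Ψ` cancels `G` and leaves `H - deltaEven d Ψ`. This element contains no
even generators, because `deltaEven d` trades the single even generator of the mixed part of `Ψ` for
an odd one. It is `δ₀`-closed since `δ₀² = 0`, and hence `δ`-closed, since the two differentials
agree in the absence of even generators. The regularity condition makes it a boundary, and so `Φ` is
one (`TwoHomologyRegular.mem_boundaries₂`). Conversely, a `δ`-cycle `H` of degree two is a reduction
condition with `G = 0 = δ 0`; it is trivial, hence a boundary (`twoHomologyRegular_of_trivial`). -/

namespace KoszulTate

section Algebra
variable {R M N : Type*} [CommRing R] [AddCommGroup M] [Module R M] [AddCommGroup N] [Module R N]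

/-! ### Nilpotency of the extended differential -/

/-- The sign in the graded Leibniz rule makes the two terms `ε c • δ₀ f` cancel. Nothing is required
of `d` here. -/
theorem delta₀_delta₀_mul_odd {ε : M →ₗ[R] R} {d : N →ₗ[R] M} {f : GradedRing R M N}
    (hf : delta₀ ε d (delta₀ ε d f) = 0) (c : M) :
    delta₀ ε d (delta₀ ε d (f * odd N c)) = 0 := by
  rw [delta₀_mul_odd, map_sub, map_smul, delta₀_mul_odd, hf, zero_mul, sub_zero, sub_self]

/-- The two terms `δ₀ f · d c` cancel by the sign of the odd rule. What remains is `ε (d c) • f`,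
and this is where `ε ∘ d = 0` is needed. -/
theorem delta₀_delta₀_mul_even {ε : M →ₗ[R] R} {d : N →ₗ[R] M} (hd : ∀ n, ε (d n) = 0)
    {f : GradedRing R M N} (hf : delta₀ ε d (delta₀ ε d f) = 0) (c : N) :
    delta₀ ε d (delta₀ ε d (f * even M c)) = 0 := by
  rw [delta₀_mul_even, map_add, delta₀_mul_even, delta₀_mul_odd, hf, hd, zero_mul, zero_smul,
    zero_add, zero_sub, add_neg_cancel]

/-- The Leibniz rules at hand concern right multiplication by one generator. Stating the claim as
stability of `ker δ₀²` under right multiplication lets generators be appended one at a time, without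
a Leibniz rule for general products. The element `f` is quantified inside the induction because the
product case applies the hypothesis for `b` to `f` times `a`. -/
theorem delta₀_delta₀_mul_exterior {ε : M →ₗ[R] R} {d : N →ₗ[R] M} (a : ExteriorAlgebra R M) :
    ∀ f : GradedRing R M N, delta₀ ε d (delta₀ ε d f) = 0 →
      delta₀ ε d (delta₀ ε d (f * tmul R M N a 1)) = 0 := by
  induction a using ExteriorAlgebra.induction with
  | algebraMap r =>
    intro f hf
    have : tmul R M N (algebraMap R _ r) 1 = r • (1 : GradedRing R M N) := by
      rw [Algebra.algebraMap_eq_smul_one, map_smul, LinearMap.smul_apply]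
      rfl
    rw [this, mul_smul_comm, mul_one, map_smul, map_smul, hf, smul_zero]
  -- `odd N c` unfolds to `tmul R M N (ι c) 1`.
  | ι c => exact fun f hf => delta₀_delta₀_mul_odd hf c
  | mul a b ha hb =>
    intro f hf
    have := hb _ (ha f hf)
    rwa [mul_assoc, tmul_mul_tmul, one_mul] at this
  | add a b ha hb =>
    intro f hf
    rw [map_add, LinearMap.add_apply, mul_add, map_add, map_add, ha f hf, hb f hf, add_zero]

theorem delta₀_delta₀_mul_symmetric {ε : M →ₗ[R] R} {d : N →ₗ[R] M} (hd : ∀ n, ε (d n) = 0)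
    (p : SymmetricAlgebra R N) :
    ∀ f : GradedRing R M N, delta₀ ε d (delta₀ ε d f) = 0 →
      delta₀ ε d (delta₀ ε d (f * tmul R M N 1 p)) = 0 := by
  induction p using SymmetricAlgebra.induction with
  | algebraMap r =>
    intro f hf
    have : tmul R M N 1 (algebraMap R _ r) = r • (1 : GradedRing R M N) := by
      rw [Algebra.algebraMap_eq_smul_one, map_smul]
      rfl
    rw [this, mul_smul_comm, mul_one, map_smul, map_smul, hf, smul_zero]
  | ι c => exact fun f hf => delta₀_delta₀_mul_even hd hf c
  | mul p q hp hq =>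
    intro f hf
    have := hq _ (hp f hf)
    rwa [mul_assoc, tmul_mul_tmul, one_mul] at this
  | add p q hp hq =>
    intro f hf
    rw [map_add, mul_add, map_add, map_add, hp f hf, hq f hf, add_zero]

/-- The extended differential squares to zero if the `d n` are cycles. -/
theorem delta₀_delta₀ {ε : M →ₗ[R] R} {d : N →ₗ[R] M} (hd : ∀ n, ε (d n) = 0)
    (f : GradedRing R M N) : delta₀ ε d (delta₀ ε d f) = 0 := by
  induction f using induct with
  | h0 => simp
  | ha f g hf hg => rw [map_add, map_add, hf, hg, add_zero]
  | ht a p =>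
    -- The tensor `a ⊗ p` is `1 · (a ⊗ 1) · (1 ⊗ p)`, so it is reached from `1`, where `δ₀` already
    -- vanishes.
    have h := delta₀_delta₀_mul_symmetric hd p _
      (delta₀_delta₀_mul_exterior (ε := ε) (d := d) a 1 (by rw [delta₀_one, map_zero]))
    rwa [one_mul, tmul_mul_tmul, mul_one, one_mul] at h

/-! ### Effect of the even part of the differential on bidegrees -/

/-- In even degree zero the symmetric factor is a scalar, and a derivation over `R` kills scalars.
-/
theorem deltaEven_of_mem_bidegree_zero (d : N →ₗ[R] M) {k : ℕ} {f : GradedRing R M N}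
    (hf : f ∈ bidegree R M N k 0) : deltaEven d f = 0 := by
  have : bidegree R M N k 0 ≤ LinearMap.ker (deltaEven d) := by
    refine Submodule.map₂_le.2 fun a _ p hp => ?_
    rw [pow_zero] at hp
    obtain ⟨r, rfl⟩ := Submodule.mem_one.1 hp
    rw [LinearMap.mem_ker, deltaEven_tmul, Algebra.algebraMap_eq_smul_one, map_smul, symDer_one,
      smul_zero, map_zero]
  exact this hf

/-- The single even generator `n` is replaced by the odd element `d n`, which raises the odd degree
by one. -/
theorem deltaEven_mem_bidegree_of_one (d : N →ₗ[R] M) {k : ℕ} {f : GradedRing R M N}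
    (hf : f ∈ bidegree R M N k 1) : deltaEven d f ∈ bidegree R M N (k + 1) 0 := by
  have : bidegree R M N k 1 ≤ (bidegree R M N (k + 1) 0).comap (deltaEven d) := by
    refine Submodule.map₂_le.2 fun a ha p hp => ?_
    rw [pow_one] at hp
    obtain ⟨n, rfl⟩ := hp
    rw [Submodule.mem_comap, deltaEven_tmul, symDer_ι, attach_tmul]
    refine Submodule.apply_mem_map₂ _ ?_ ?_
    -- The exterior power is by definition a power of the submodule of generators.
    · change _ ∈ (LinearMap.range (ExteriorAlgebra.ι R (M := M))) ^ (k + 1)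
      rw [pow_succ]
      exact Submodule.mul_mem_mul ha ⟨_, rfl⟩
    · rw [pow_zero]
      exact Submodule.one_le.1 le_rfl
  exact this hf

/-- Antifield number three leaves only the bidegrees `(3, 0)` and `(1, 1)`; the former is killed and
the latter moves to `(2, 0)`. Consequently the difference of `δ₀ Ψ` and `δ Ψ` can be absorbed in the
summand `H` of a reduction condition. -/
theorem deltaEven_mem_of_mem_antifield_three (d : N →ₗ[R] M) {f : GradedRing R M N}
    (hf : f ∈ antifield R M N 3) : deltaEven d f ∈ bidegree R M N 2 0 := by
  have : antifield R M N 3 ≤ (bidegree R M N 2 0).comap (deltaEven d) := by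
    refine iSup_le fun k => iSup_le fun m => iSup_le fun h => ?_
    obtain ⟨rfl, rfl⟩ | ⟨rfl, rfl⟩ : (k = 3 ∧ m = 0) ∨ (k = 1 ∧ m = 1) := by omega
    · intro x hx
      rw [Submodule.mem_comap, deltaEven_of_mem_bidegree_zero d hx]
      exact zero_mem _
    · exact fun x hx => deltaEven_mem_bidegree_of_one d hx
  exact this hf

/-- This allows cycles without even generators to be passed between `δ` and `δ₀`, which both
implications use. -/
theorem delta₀_of_mem_bidegree_zero (ε : M →ₗ[R] R) (d : N →ₗ[R] M) {k : ℕ}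
    {f : GradedRing R M N} (hf : f ∈ bidegree R M N k 0) : delta₀ ε d f = delta N ε f := by
  rw [delta₀, LinearMap.add_apply, deltaEven_of_mem_bidegree_zero d hf, add_zero]

/-! ### Trivial reduction conditions and boundaries -/

theorem homologyClass_eq_zero_iff {ε : M →ₗ[R] R} {d : N →ₗ[R] M} (Φ : cycles₂ ε d) :
    homologyClass ε d Φ = 0 ↔ Φ.1 ∈ boundaries₂ ε d := by
  rw [homologyClass, Submodule.mkQ_apply, Submodule.Quotient.mk_eq_zero]
  rfl

/-- Modulo the boundary `δ₀ Ψ`, a reduction condition with `G = δ Ψ` becomes a `δ`-cycle of degree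
two in the odd generators, to which the regularity condition applies. -/
theorem TwoHomologyRegular.mem_boundaries₂ {ε : M →ₗ[R] R} {d : N →ₗ[R] M}
    (h : TwoHomologyRegular ε d) (hd : ∀ n, ε (d n) = 0) {Φ : cycles₂ ε d}
    (hΦ : IsTrivialReduction ε d Φ) : Φ.1 ∈ boundaries₂ ε d := by
  obtain hΦ | ⟨G, -, H, hH, hGH, Ψ, hΨ, rfl⟩ := hΦ
  · exact hΦ
  have hmem : H - deltaEven d Ψ ∈ bidegree R M N 2 0 :=
    sub_mem hH (deltaEven_mem_of_mem_antifield_three d hΨ)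
  have heq : Φ.1 = (H - deltaEven d Ψ) + delta₀ ε d Ψ := by
    rw [hGH, delta₀, LinearMap.add_apply]
    abel
  -- The remainder equals `Φ - δ₀ Ψ`, a difference of two `δ₀`-cycles; its bidegree `(2, 0)` turns
  -- `δ₀` into `δ`.
  have hcyc : delta N ε (H - deltaEven d Ψ) = 0 := by
    rw [← delta₀_of_mem_bidegree_zero ε d hmem, eq_sub_of_add_eq heq.symm, map_sub,
      delta₀_delta₀ hd, LinearMap.mem_ker.1 Φ.2.2, sub_zero]
  rw [heq]
  exact add_mem (h _ hmem hcyc) (Submodule.mem_map_of_mem hΨ)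

/-- A `δ`-cycle without even generators is a reduction condition whose summand `G` is zero, and zero
is `δ`-exact with `Ψ = 0`. This direction does not need `δ₀² = 0`. -/
theorem twoHomologyRegular_of_trivial {ε : M →ₗ[R] R} {d : N →ₗ[R] M}
    (h : ∀ Φ : cycles₂ ε d, IsTrivialReduction ε d Φ → Φ.1 ∈ boundaries₂ ε d) :
    TwoHomologyRegular ε d := by
  intro Φ hΦ hc
  have hmem : Φ ∈ antifield R M N 2 :=
    le_iSup₂_of_le (f := fun k m => ⨆ _ : k + 2 * m = 2, bidegree R M N k m) 2 0
      (le_iSup_of_le rfl le_rfl) hΦ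
  exact h ⟨Φ, hmem, LinearMap.mem_ker.2 ((delta₀_of_mem_bidegree_zero ε d hΦ).trans hc)⟩
    (Or.inr ⟨0, zero_mem _, Φ, hΦ, (zero_add Φ).symm, 0, zero_mem _, map_zero _⟩)

/-- After both sides of the inner equivalence are stripped of their negations, it compares trivial
conditions with boundaries. One inclusion is the first alternative in the definition of triviality,
so the content is the other one. -/
theorem firstStage_iff_homologyClass_ne_zero_iff {ε : M →ₗ[R] R} {d : N →ₗ[R] M}
    (hd : ∀ n, ε (d n) = 0) :
    (∀ Φ : cycles₂ ε d, IsFirstStageNoetherIdentity ε d Φ ↔ homologyClass ε d Φ ≠ 0) ↔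
      TwoHomologyRegular ε d := by
  simp only [IsFirstStageNoetherIdentity, ne_eq, not_iff_not, homologyClass_eq_zero_iff]
  exact ⟨fun h => twoHomologyRegular_of_trivial fun Φ => (h Φ).1,
    fun h Φ => ⟨h.mem_boundaries₂ hd, Or.inl⟩⟩

end Algebra

/-! ### The Noether identities on jets, and the conclusion -/

open scoped Manifold

/-- The Noether identities in terms of linear forms. -/
theorem CompleteNoetherOperators.evalForm_compForm {B C F F₀ : Type*}
    [NormedAddCommGroup B] [NormedSpace ℝ B] [NormedAddCommGroup C] [NormedSpace ℝ C]
    [NormedAddCommGroup F] [NormedSpace ℝ F] [NormedAddCommGroup F₀] [NormedSpace ℝ F₀]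
    {X Y : Type*} [TopologicalSpace X] [ChartedSpace B X] [IsManifold 𝓘(ℝ, B) ∞ X]
    [TopologicalSpace Y] [ChartedSpace C Y] [IsManifold 𝓘(ℝ, C) ∞ Y] {π : Y → X}
    {E : X → Type*} [∀ x, AddCommGroup (E x)] [∀ x, Module ℝ (E x)]
    [∀ x, TopologicalSpace (E x)] [TopologicalSpace (Bundle.TotalSpace F E)]
    [FiberBundle F E] [VectorBundle ℝ F E] [ContMDiffVectorBundle ∞ F E 𝓘(ℝ, B)]
    {E₀ : X → Type*} [∀ x, AddCommGroup (E₀ x)] [∀ x, Module ℝ (E₀ x)]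
    [∀ x, TopologicalSpace (E₀ x)] [TopologicalSpace (Bundle.TotalSpace F₀ E₀)]
    [FiberBundle F₀ E₀] [VectorBundle ℝ F₀ E₀] [ContMDiffVectorBundle ∞ F₀ E₀ 𝓘(ℝ, B)]
    {𝓔 : DifferentialOperator B C π F E} (Δ : CompleteNoetherOperators F₀ E₀ 𝓔)
    (G : FormModule B C π F₀ E₀) : 𝓔.evalForm (Δ.compForm G) = 0 := by
  refine Subtype.ext (funext fun p => ?_)
  change G.1 p (Δ.prolong p (𝓔.prolong p)) = 0
  rw [← map_zero (G.1 p)]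
  -- `G` may involve derivatives of its argument, so vanishing at `p.pt` alone would not suffice.
  -- The section must vanish as a germ, and then linearity of `G p` gives zero.
  refine LinearForms.congr F₀ E₀ G p ?_
  -- Both sections stay smooth at nearby points, so there `sectionFun` is the actual value of the
  -- operator and not its default value zero.
  filter_upwards [p.isLocalSection.eventually_nhds,
    Filter.Eventually.eventually_nhds (𝓔.prolong p).2] with y h1 h2
  change Δ.sectionFun p (𝓔.prolong p).1 y = 0
  rw [Δ.sectionFun_of h1 h2]
  -- The Noether identity is applied at the moved point `y`. Moving the base point does not change
  -- the section produced by `𝓔`, so the two arguments agree by definition.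
  exact Δ.noether (p.move y h1)

end KoszulTate

-- The algebraic equivalence is applied over the ring of jet functions, with `M` and `N` the linear
-- forms on jets of sections of `E` and `E₀`, `ε` evaluation on `𝓔`, and `d` composition with the
-- Noether operators.
open KoszulTate in
theorem proposition4 {B C D F F₀ : Type*}
    [NormedAddCommGroup B] [NormedSpace ℝ B] [FiniteDimensional ℝ B]
    [NormedAddCommGroup C] [NormedSpace ℝ C] [FiniteDimensional ℝ C]
    [NormedAddCommGroup D] [NormedSpace ℝ D] [FiniteDimensional ℝ D]
    [NormedAddCommGroup F] [NormedSpace ℝ F] [FiniteDimensional ℝ F]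
    [NormedAddCommGroup F₀] [NormedSpace ℝ F₀] [FiniteDimensional ℝ F₀]
    {X Y V : Type*}
    [TopologicalSpace X] [ChartedSpace B X] [IsManifold (modelWithCornersSelf ℝ B) ∞ X]
    [T2Space X] [SecondCountableTopology X]
    [TopologicalSpace Y] [ChartedSpace C Y] [IsManifold (modelWithCornersSelf ℝ C) ∞ Y]
    [T2Space Y] [SecondCountableTopology Y]
    [TopologicalSpace V] [ChartedSpace D V] [IsManifold (modelWithCornersSelf ℝ D) ∞ V]
    (π : Y → X) (hπ : IsSmoothFiberBundle B C π (D := D) V)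
    (E : X → Type*) [∀ x, AddCommGroup (E x)] [∀ x, Module ℝ (E x)]
    [∀ x, TopologicalSpace (E x)] [TopologicalSpace (Bundle.TotalSpace F E)]
    [FiberBundle F E] [VectorBundle ℝ F E]
    [ContMDiffVectorBundle ∞ F E (modelWithCornersSelf ℝ B)]
    (E₀ : X → Type*) [∀ x, AddCommGroup (E₀ x)] [∀ x, Module ℝ (E₀ x)]
    [∀ x, TopologicalSpace (E₀ x)] [TopologicalSpace (Bundle.TotalSpace F₀ E₀)]
    [FiberBundle F₀ E₀] [VectorBundle ℝ F₀ E₀]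
    [ContMDiffVectorBundle ∞ F₀ E₀ (modelWithCornersSelf ℝ B)]
    (𝓔 : DifferentialOperator B C π F E) (Δ : CompleteNoetherOperators F₀ E₀ 𝓔) :
    (∀ Φ : cycles₂ 𝓔.evalForm Δ.compForm,
      IsFirstStageNoetherIdentity 𝓔.evalForm Δ.compForm Φ ↔
        homologyClass 𝓔.evalForm Δ.compForm Φ ≠ 0) ↔
      TwoHomologyRegular 𝓔.evalForm Δ.compForm :=
  firstStage_iff_homologyClass_ne_zero_iff Δ.evalForm_compForm
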